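/- A \emph{cycle set} is a set $X$ with a binary operation $\cdot$ such that each left multiplication $\sigma_x\colon X\to X$, $y\mapsto x\cdot y$, is bijective, $(x\cdot y)\cdot(x\cdot z)=(y\cdot x)\cdot(y\cdot z)$ for all $x,y,z\in X$, and the squaring map $x\mapsto x\cdot x$ is bijective (non-degeneracy). Its permutation group is the subgroup $\mathcal G(X)=\langle \sigma_x \mid x\in X\rangle$ of $\mathrm{Sym}(X)$, and $X$ is \emph{indecomposable} if $\mathcal G(X)$ acts transitively on $X$. The direct product of cycle sets is their Cartesian product with the componentwise operation, and an isomorphism is a bijection that preserves the operation. \textbf{Theorem.} Let $X$ be a finite nonempty indecomposable cycle set whose permutation group $\mathcal G(X)$ is the (internal) direct product of $r$ nontrivial subgroups $B_1,\dots,B_r$ of pairwise coprime orders. Then there are $r$ cycle sets $X_1,\dots,X_r$ such that $X$ is isomorphic to the direct product $X_1\times\cdots\times X_r$ and, for each $i$, $|X_i|>1$ and $|X_i|$ divides $|B_i|$. -/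

import Mathlib

universe u

/-- A (non-degenerate) cycle set: a set with a binary operation, written `x * y`, such that
every left multiplication `y ↦ x * y` is bijective, the cycloid equation
`(x * y) * (x * z) = (y * x) * (y * z)` holds, and the squaring map `x ↦ x * x` is bijective
(non-degeneracy). -/
class CycleSet (X : Type*) extends Mul X where
  bijective_left : ∀ x : X, Function.Bijective (fun y : X => x * y)
  cycloid : ∀ x y z : X, (x * y) * (x * z) = (y * x) * (y * z)
  bijective_square : Function.Bijective (fun x : X => x * x)

namespace CycleSet

/-- The left multiplication `σ_x : y ↦ x * y`, as a permutation of `X`. -/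
noncomputable def sigma {X : Type*} [CycleSet X] (x : X) : Equiv.Perm X :=
  Equiv.ofBijective (fun y : X => x * y) (bijective_left x)

/-- The associated permutation group `𝒢(X)`: the subgroup of `Sym(X)` generated by all `σ_x`. -/
def permGroup (X : Type*) [CycleSet X] : Subgroup (Equiv.Perm X) :=
  Subgroup.closure (Set.range (sigma : X → Equiv.Perm X))

/-- A cycle set is indecomposable if its permutation group acts transitively on it. -/
def Indecomposable (X : Type*) [CycleSet X] : Prop :=
  MulAction.IsPretransitive (permGroup X) X

/-- The direct product of cycle sets, with the componentwise operation. -/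
instance pi {ι : Type*} (Y : ι → Type*) [∀ i, CycleSet (Y i)] : CycleSet (∀ i, Y i) where
  toMul := Pi.instMul
  bijective_left x := Function.Bijective.piMap fun i => bijective_left (x i)
  cycloid x y z := funext fun i => cycloid (x i) (y i) (z i)
  bijective_square := Function.Bijective.piMap fun i => bijective_square (X := Y i)

end CycleSet

/-- The group `G` is the (internal) direct product of the subgroups `B i`: they are normal, they
generate `G`, and each meets the subgroup generated by all the others trivially. -/
def IsInternalDirectProduct {G : Type*} [Group G] {ι : Type*} (B : ι → Subgroup G) : Prop :=
  (∀ i, (B i).Normal) ∧ (⨆ i, B i) = ⊤ ∧ ∀ i, Disjoint (B i) (⨆ j, ⨆ (_ : j ≠ i), B j)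

/-! Write `G` for the permutation group. The maps `g ↦ g * σ_{g⁻¹ y}⁻¹` commute by the cycloid
equation, are permuted by conjugation with left translations, and generate a regular group `A` on
`G`, the additive group of a brace.

In `A`, the elements killed by a given `n` are stable under that conjugation, so their values at `1`
form a subgroup of `G` of the same order; any homomorphism to a group of order prime to `n` kills
it. Splitting `A` into coprime torsion parts shows that the `B i`-component of `σ_x` depends only on
the orbit of `x` under the kernel of the projection to `B i` (`map_permGroupSigma_smul`). Hence
these orbits form a cycle set, and coprimality with transitivity makes `X` the product of these
quotients (`MulAction.bijective_pi_orbitQuotient_ker`). -/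

/-! ### Regular abelian groups normalized by the left translations -/

/-- If `A` is a commutative group of permutations of a finite group `G`, transitive and normalized
by the left translations, then elements of `A` of order prime to `|Q|` preserve the fibres of any
homomorphism `G →* Q`. -/
theorem map_apply_eq_of_pow_eq_one {G Q : Type*} [Group G] [Finite G] [Group Q] [Finite Q]
    {A : Subgroup (Equiv.Perm G)} (hcomm : ∀ a ∈ A, ∀ b ∈ A, a * b = b * a)
    (hnorm : ∀ h : G, ∀ a ∈ A, Equiv.mulLeft h * a * (Equiv.mulLeft h)⁻¹ ∈ A)
    (htrans : ∀ g : G, ∃ a ∈ A, a 1 = g)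
    (q : G →* Q) {n : ℕ} (hn : n.Coprime (Nat.card Q))
    {b : Equiv.Perm G} (hb : b ∈ A) (hbn : b ^ n = 1) (g : G) : q (b g) = q g := by
  have hfree : ∀ a ∈ A, a 1 = 1 → a = 1 := by
    intro a ha h1
    ext g
    obtain ⟨c, hc, rfl⟩ := htrans g
    rw [← Equiv.Perm.mul_apply, hcomm a ha c hc, Equiv.Perm.mul_apply, h1, Equiv.Perm.one_apply]
  have hconj : ∀ (h : G) (a : Equiv.Perm G), a ^ n = 1 →
      (Equiv.mulLeft h * a * (Equiv.mulLeft h)⁻¹) ^ n = 1 := by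
    intro h a ha
    rw [conj_pow, ha, mul_one, mul_inv_cancel]
  let T : Subgroup (Equiv.Perm G) :=
    { carrier := {a | a ∈ A ∧ a ^ n = 1}
      mul_mem' := by
        rintro x y ⟨hx, hx'⟩ ⟨hy, hy'⟩
        exact ⟨mul_mem hx hy, by rw [Commute.mul_pow (hcomm x hx y hy), hx', hy', mul_one]⟩
      one_mem' := ⟨one_mem _, one_pow _⟩
      inv_mem' := by
        rintro x ⟨hx, hx'⟩
        exact ⟨inv_mem hx, by rw [inv_pow, hx', inv_one]⟩ }
  -- With `L` the left translation by `a 1`, `a 1 * c 1 = (L * c * L⁻¹ * a) 1`, so the orbit of `1`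
  -- under `T` is closed under products; finiteness of `G` gives inverses.
  let M : Submonoid G :=
    { carrier := {g | ∃ a ∈ T, a 1 = g}
      mul_mem' := by
        rintro _ _ ⟨a, ⟨ha, ha'⟩, rfl⟩ ⟨c, ⟨hc, hc'⟩, rfl⟩
        refine ⟨Equiv.mulLeft (a 1) * c * (Equiv.mulLeft (a 1))⁻¹ * a,
          mul_mem (S := Subgroup _) (s := T) ⟨hnorm _ _ hc, hconj _ _ hc'⟩ ⟨ha, ha'⟩, ?_⟩
        simp [Equiv.Perm.mul_apply]
      one_mem' := ⟨1, one_mem _, rfl⟩ }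
  let C : Subgroup G :=
    { M with
      inv_mem' := by
        intro x hx
        obtain ⟨k, hk⟩ := (mem_powers_iff_mem_zpowers (x := x) (y := x⁻¹)).2
          (inv_mem (Subgroup.mem_zpowers x))
        exact hk ▸ M.pow_mem hx k }
  have hcard : Nat.card T = Nat.card C := by
    refine Nat.card_congr (Equiv.ofBijective (fun a : T => (⟨a.1 1, a.1, a.2, rfl⟩ : C)) ⟨?_, ?_⟩)
    · intro a c hac
      have h1 : a.1 1 = c.1 1 := congrArg Subtype.val hac
      have h2 := hfree (c.1⁻¹ * a.1) (mul_mem (inv_mem c.2.1) a.2.1) (by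
        rw [Equiv.Perm.mul_apply, h1, Equiv.Perm.inv_eq_iff_eq])
      exact Subtype.ext (inv_mul_eq_one.1 h2).symm
    · rintro ⟨_, a, ha, rfl⟩
      exact ⟨⟨a, ha⟩, rfl⟩
  -- By Cauchy, every prime dividing `|T|` is the order of an element killed by `n`.
  have hTQ : (Nat.card T).Coprime (Nat.card Q) := by
    refine Nat.Coprime.symm (Nat.coprime_of_dvd fun k hk hkQ hkT => ?_)
    have := Fact.mk hk
    obtain ⟨x, hx⟩ := exists_prime_orderOf_dvd_card' k hkT
    have hkn : k ∣ n := hx ▸ orderOf_dvd_of_pow_eq_one (Subtype.ext x.2.2)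
    exact hk.one_lt.ne' (Nat.dvd_one.1 (hn ▸ Nat.dvd_gcd hkn hkQ))
  have hC : ∀ c ∈ C, q c = 1 := by
    intro c hc
    rw [← orderOf_eq_one_iff]
    refine Nat.dvd_one.1 (hTQ ▸ Nat.dvd_gcd ?_ (orderOf_dvd_natCard (q c)))
    rw [hcard]
    refine (orderOf_map_dvd q c).trans ?_
    have := orderOf_dvd_natCard (⟨c, hc⟩ : C)
    rwa [Subgroup.orderOf_mk] at this
  -- This value is `g⁻¹ * b g`.
  have hmem : (Equiv.mulLeft g⁻¹ * b * (Equiv.mulLeft g⁻¹)⁻¹) 1 ∈ C :=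
    ⟨_, ⟨hnorm _ _ hb, hconj _ _ hbn⟩, rfl⟩
  have := hC _ hmem
  simp [Equiv.Perm.mul_apply] at this
  exact (inv_mul_eq_one.1 this).symm

/-- Let `A` be a commutative group of permutations of a finite group `G`, transitive and normalized
by the left translations. If `G` embeds into `P × Q` with `|P|` and `|Q|` coprime, then each
element of `A` maps the kernel of `G →* P` into a single fibre. -/
theorem map_apply_eq_map_apply_one {G P Q : Type*} [Group G] [Finite G] [Group P] [Finite P]
    [Group Q] [Finite Q]
    {A : Subgroup (Equiv.Perm G)} (hcomm : ∀ a ∈ A, ∀ b ∈ A, a * b = b * a)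
    (hnorm : ∀ h : G, ∀ a ∈ A, Equiv.mulLeft h * a * (Equiv.mulLeft h)⁻¹ ∈ A)
    (htrans : ∀ g : G, ∃ a ∈ A, a 1 = g)
    (p : G →* P) (q : G →* Q) (hpq : ∀ g, p g = 1 → q g = 1 → g = 1)
    (hcop : (Nat.card P).Coprime (Nat.card Q))
    {a : Equiv.Perm G} (ha : a ∈ A) {h : G} (hh : p h = 1) : p (a h) = p (a 1) := by
  have hP := fun {b : Equiv.Perm G} (hb : b ∈ A) => map_apply_eq_of_pow_eq_one hcomm hnorm htrans p
    (n := Nat.card Q) hcop.symm hb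
  have hQ := fun {b : Equiv.Perm G} (hb : b ∈ A) => map_apply_eq_of_pow_eq_one hcomm hnorm htrans q
    (n := Nat.card P) hcop hb
  have hcardA : Nat.card A = Nat.card G := by
    refine Nat.card_congr (Equiv.ofBijective (fun a : A => a.1 1) ⟨?_, ?_⟩)
    · intro b c hbc
      ext g
      obtain ⟨d, hd, rfl⟩ := htrans g
      rw [← Equiv.Perm.mul_apply, ← Equiv.Perm.mul_apply, hcomm _ b.2 _ hd, hcomm _ c.2 _ hd]
      exact congrArg d hbc
    · intro g
      obtain ⟨d, hd, rfl⟩ := htrans g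
      exact ⟨⟨d, hd⟩, rfl⟩
  have hcardG : Nat.card G ∣ Nat.card P * Nat.card Q := by
    rw [← Nat.card_prod]
    refine Subgroup.card_dvd_of_injective (p.prod q) ((injective_iff_map_eq_one _).2 fun g hg => ?_)
    exact hpq g (congrArg Prod.fst hg) (congrArg Prod.snd hg)
  -- Bézout splits `a` into commuting powers killed by `|P|` and by `|Q|`.
  have hdec : ∀ a ∈ A, ∃ b ∈ A, ∃ c ∈ A, b ^ Nat.card P = 1 ∧ c ^ Nat.card Q = 1 ∧ a = c * b := by
    intro a ha
    have h1 : a ^ (Nat.card P * Nat.card Q) = 1 := by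
      rw [← orderOf_dvd_iff_pow_eq_one]
      refine dvd_trans ?_ (hcardA ▸ hcardG)
      have := orderOf_dvd_natCard (⟨a, ha⟩ : A)
      rwa [Subgroup.orderOf_mk] at this
    have h2 : a ^ ((Nat.card P : ℤ) * Nat.card Q) = 1 := by exact_mod_cast h1
    have hbez := Nat.gcd_eq_gcd_ab (Nat.card P) (Nat.card Q)
    rw [hcop, Nat.cast_one] at hbez
    refine ⟨a ^ ((Nat.card Q : ℤ) * (Nat.card P).gcdB (Nat.card Q)), zpow_mem ha _,
      a ^ ((Nat.card P : ℤ) * (Nat.card P).gcdA (Nat.card Q)), zpow_mem ha _, ?_, ?_, ?_⟩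
    · rw [← zpow_natCast, ← zpow_mul, mul_comm, ← mul_assoc, zpow_mul, h2, one_zpow]
    · rw [← zpow_natCast, ← zpow_mul, mul_right_comm, zpow_mul, h2, one_zpow]
    · rw [← zpow_add, ← hbez, zpow_one]
  obtain ⟨b, hb, c, hc, hbP, hcQ, rfl⟩ := hdec a ha
  obtain ⟨d, hd, rfl⟩ := htrans h
  obtain ⟨b', hb', c', hc', hbP', hcQ', rfl⟩ := hdec d hd
  -- `c'` preserves `p` and `b'` preserves `q`, so `b' 1` lies in both kernels. Thus `h = c' 1`, and
  -- `c'` can be moved past `b` and dropped under `p`.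
  have h1 : b' 1 = 1 := by
    refine hpq _ ?_ ?_
    · rwa [Equiv.Perm.mul_apply, hP hc' hcQ'] at hh
    · rw [hQ hb' hbP', map_one]
  rw [Equiv.Perm.mul_apply, Equiv.Perm.mul_apply, Equiv.Perm.mul_apply, hP hc hcQ, hP hc hcQ, h1,
    ← Equiv.Perm.mul_apply, hcomm b hb c' hc', Equiv.Perm.mul_apply, hP hc' hcQ']

/-! ### Orbits of kernels and products of coprime groups -/

/-- The action of a group on the set of orbits of a normal subgroup. -/
abbrev MulAction.orbitQuotientOfNormal {G : Type*} (X : Type*) [Group G] [MulAction G X]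
    (N : Subgroup G) [hN : N.Normal] : MulAction G (MulAction.orbitRel.Quotient N X) where
  smul g := Quotient.map' (fun x => g • x) (by
    rintro _ y ⟨n, rfl⟩
    exact ⟨⟨g * n * g⁻¹, hN.conj_mem _ n.2 g⟩, by simp [Subgroup.smul_def, mul_smul]⟩)
  one_smul y := Quotient.inductionOn' y fun x => congrArg Quotient.mk'' (one_smul G x)
  mul_smul g h y := Quotient.inductionOn' y fun x => congrArg Quotient.mk'' (mul_smul g h x)

/-- If `G` acts transitively, then the number of orbits of the kernel of a homomorphism `G →* H`
divides the order of `H`. -/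
theorem MulAction.card_orbitQuotient_ker_dvd {G H X : Type*} [Group G] [Group H] [MulAction G X]
    [MulAction.IsPretransitive G X] [Nonempty X] (p : G →* H) :
    Nat.card (MulAction.orbitRel.Quotient p.ker X) ∣ Nat.card H := by
  let _ := MulAction.orbitQuotientOfNormal X p.ker
  obtain ⟨x⟩ := ‹Nonempty X›
  have hpre : MulAction.IsPretransitive G (MulAction.orbitRel.Quotient p.ker X) := by
    refine ⟨fun a b => Quotient.inductionOn₂' a b fun y z => ?_⟩
    obtain ⟨g, rfl⟩ := MulAction.exists_smul_eq G y z
    exact ⟨g, rfl⟩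
  let x' : MulAction.orbitRel.Quotient p.ker X := Quotient.mk'' x
  rw [← MulAction.index_stabilizer_of_transitive G x']
  refine (Subgroup.index_dvd_of_le (H := p.ker) fun g hg => ?_).trans ?_
  · exact Quotient.sound' ⟨⟨g, hg⟩, rfl⟩
  · rw [Subgroup.index_ker]
    exact Subgroup.card_subgroup_dvd_card _

/-- A subgroup of a finite product of groups of pairwise coprime orders contains the components of
its elements. -/
theorem Subgroup.mulSingle_mem_of_coprime {ι : Type*} [Finite ι] [DecidableEq ι] {H : ι → Type*}
    [∀ i, Group (H i)] (hcop : Pairwise fun i j => (Nat.card (H i)).Coprime (Nat.card (H j)))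
    {S : Subgroup (∀ i, H i)} {s : ∀ i, H i} (hs : s ∈ S) (i : ι) : Pi.mulSingle i (s i) ∈ S := by
  have := Fintype.ofFinite ι
  -- Raising to the power `c` fixes the component `i` and kills the others.
  obtain ⟨c, hc, hc'⟩ := Nat.chineseRemainder
    (Nat.Coprime.prod_right fun j (hj : j ∈ Finset.univ.erase i) =>
      hcop (Finset.ne_of_mem_erase hj).symm) 1 0
  convert pow_mem hs c
  ext j
  rw [Pi.pow_apply]
  by_cases hj : j = i
  · subst hj
    rw [Pi.mulSingle_eq_same]
    simpa using (pow_eq_pow_iff_modEq.2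
      (hc.of_dvd (_root_.orderOf_dvd_natCard (s j)))).symm
  · rw [Pi.mulSingle_eq_of_ne hj, eq_comm, ← orderOf_dvd_iff_pow_eq_one]
    exact ((_root_.orderOf_dvd_natCard (s j)).trans
      (Finset.dvd_prod_of_mem (fun j => Nat.card (H j))
        (Finset.mem_erase.2 ⟨hj, Finset.mem_univ j⟩))).trans (Nat.modEq_zero_iff_dvd.1 hc')

/-- If a finite product of groups of pairwise coprime orders acts transitively on `X`, then `X` is
the product of the sets of orbits of the kernels of the projections. -/
theorem MulAction.bijective_pi_orbitQuotient_ker {ι : Type*} [Finite ι] {G X : Type*}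
    {H : ι → Type*} [Group G] [∀ i, Group (H i)] [MulAction G X] [MulAction.IsPretransitive G X]
    [Nonempty X] (hcop : Pairwise fun i j => (Nat.card (H i)).Coprime (Nat.card (H j)))
    (e : G ≃* ∀ i, H i) (p : ∀ i, G →* H i) (hp : ∀ i g, p i g = e g i) :
    Function.Bijective fun (x : X) (i : ι) =>
      (Quotient.mk'' x : MulAction.orbitRel.Quotient (p i).ker X) := by
  classical
  constructor
  · intro x y hxy
    obtain ⟨g, rfl⟩ := MulAction.exists_smul_eq G x y
    -- For each `i`, some `n * g` with `n` in the kernel of `p i` stabilizes `x` and has the same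
    -- component `i` as `g`; coprimality isolates that component.
    have hmem : e g ∈ (MulAction.stabilizer G x).map e.toMonoidHom := by
      refine Subgroup.pi_mem_of_mulSingle_mem _ fun i => ?_
      obtain ⟨⟨n, hn⟩, hnx⟩ : x ∈ MulAction.orbit (p i).ker (g • x) :=
        Quotient.exact' (congrFun hxy i)
      have hs : n * g ∈ MulAction.stabilizer G x := by
        rw [MulAction.mem_stabilizer_iff, mul_smul]
        exact hnx
      have := Subgroup.mulSingle_mem_of_coprime hcop
        (Subgroup.mem_map_of_mem e.toMonoidHom hs) i
      rw [MonoidHom.mem_ker, hp] at hn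
      simpa [hn] using this
    obtain ⟨s, hs, hsg⟩ := hmem
    rw [← e.injective hsg]
    exact hs.symm
  · intro y
    obtain ⟨x⟩ := ‹Nonempty X›
    have hy : ∀ i, ∃ g : G, Quotient.mk'' (g • x) = y i := fun i =>
      Quotient.inductionOn' (y i) fun z => by
        obtain ⟨g, rfl⟩ := MulAction.exists_smul_eq G x z
        exact ⟨g, rfl⟩
    choose g hg using hy
    refine ⟨e.symm (fun i => p i (g i)) • x, funext fun i => ?_⟩
    rw [← hg i]
    refine Quotient.sound' ⟨⟨e.symm (fun i => p i (g i)) * (g i)⁻¹, ?_⟩, ?_⟩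
    · rw [MonoidHom.mem_ker, map_mul, hp, e.apply_symm_apply, map_inv, mul_inv_cancel]
    · simp [Subgroup.smul_def, mul_smul]

/-- A group that is the internal direct product of a finite family of subgroups is isomorphic to
their product, by an isomorphism that restricts to the inclusions of the factors. -/
theorem IsInternalDirectProduct.exists_mulEquiv {G : Type*} [Group G] {ι : Type*} [Finite ι]
    [DecidableEq ι] {B : ι → Subgroup G} (hB : IsInternalDirectProduct B) :
    ∃ e : G ≃* ∀ i, B i, ∀ i (b : B i), e b = Pi.mulSingle i b := by
  have := Fintype.ofFinite ι
  obtain ⟨hnormal, htop, hdisj⟩ := hB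
  have hcomm : Pairwise fun i j : ι => ∀ x y : G, x ∈ B i → y ∈ B j → Commute x y :=
    fun i j hij => Subgroup.commute_of_normal_of_disjoint _ _ (hnormal i) (hnormal j)
      ((hdisj i).mono_right (le_iSup₂_of_le j hij.symm le_rfl))
  refine ⟨(MulEquiv.ofBijective (Subgroup.noncommPiCoprod hcomm)
    ⟨Subgroup.injective_noncommPiCoprod_of_iSupIndep hdisj, ?_⟩).symm, fun i b => ?_⟩
  · rw [← MonoidHom.range_eq_top, Subgroup.noncommPiCoprod_range, htop]
  · rw [MulEquiv.symm_apply_eq]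
    exact (Subgroup.noncommPiCoprod_mulSingle (hcomm := hcomm) i b).symm

/-! ### The brace structure on the permutation group -/

namespace CycleSet

variable {X : Type*} [CycleSet X]

/-- The left multiplication `σ_x` as an element of the permutation group. -/
noncomputable def permGroupSigma (x : X) : permGroup X :=
  ⟨sigma x, Subgroup.subset_closure ⟨x, rfl⟩⟩

theorem permGroupSigma_smul (x y : X) : permGroupSigma x • y = x * y := rfl

theorem permGroupSigma_mul (x y : X) :
    permGroupSigma (x * y) * permGroupSigma x = permGroupSigma (y * x) * permGroupSigma y :=
  Subtype.ext (Equiv.ext fun z => cycloid x y z)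

theorem inv_permGroupSigma_mul (x y : X) :
    (permGroupSigma x)⁻¹ * (permGroupSigma (x * y))⁻¹ =
      (permGroupSigma y)⁻¹ * (permGroupSigma (y * x))⁻¹ := by
  rw [← mul_inv_rev, ← mul_inv_rev, permGroupSigma_mul]

theorem closure_range_permGroupSigma :
    Subgroup.closure (Set.range (permGroupSigma : X → permGroup X)) = ⊤ := by
  refine Eq.trans ?_
    (Subgroup.closure_closure_coe_preimage (k := Set.range (sigma : X → Equiv.Perm X)))
  congr 1
  ext g
  simp only [Set.mem_range, permGroupSigma, Subtype.ext_iff]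
  rfl

variable [Finite X]

/-- The additive translation by `y` of the brace structure on the permutation group:
`g ↦ g * σ_{g⁻¹ y}⁻¹`. -/
noncomputable def translation (y : X) : Equiv.Perm (permGroup X) :=
  Equiv.ofBijective (fun g => g * (permGroupSigma (g⁻¹ • y))⁻¹) <|
    Finite.injective_iff_bijective.1 fun g h hgh => by
      -- The image of `k` determines the square of `k⁻¹ • y`, hence `k⁻¹ • y` by non-degeneracy,
      -- hence `k`.
      have key : ∀ k : permGroup X, (k * (permGroupSigma (k⁻¹ • y))⁻¹)⁻¹ • y =
          k⁻¹ • y * k⁻¹ • y := fun k => by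
        rw [mul_inv_rev, inv_inv, mul_smul, permGroupSigma_smul]
      have h1 : g⁻¹ • y = h⁻¹ • y := bijective_square.injective
        ((key g).symm.trans ((congrArg (fun k : permGroup X => k⁻¹ • y) hgh).trans (key h)))
      simpa [h1] using hgh

theorem translation_apply (y : X) (g : permGroup X) :
    translation y g = g * (permGroupSigma (g⁻¹ • y))⁻¹ := rfl

theorem translation_mul_comm (y z : X) :
    translation y * translation z = translation z * translation y := by
  ext1 g
  simp only [Equiv.Perm.mul_apply, translation_apply, mul_inv_rev, inv_inv, mul_smul,
    permGroupSigma_smul]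
  rw [mul_assoc, mul_assoc, inv_permGroupSigma_mul]

theorem mulLeft_mul_translation (h : permGroup X) (y : X) :
    Equiv.mulLeft h * translation y * (Equiv.mulLeft h)⁻¹ = translation (h • y) := by
  ext1 g
  simp [Equiv.Perm.mul_apply, translation_apply, mul_smul, mul_assoc]

variable (X) in
/-- The additive group of the brace structure on the permutation group, as a group of
permutations. -/
noncomputable def translationGroup : Subgroup (Equiv.Perm (permGroup X)) :=
  Subgroup.closure (Set.range translation)

theorem translation_mem (y : X) : translation y ∈ translationGroup X :=
  Subgroup.subset_closure ⟨y, rfl⟩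

theorem translationGroup_mul_comm (a : Equiv.Perm (permGroup X)) (ha : a ∈ translationGroup X)
    (b : Equiv.Perm (permGroup X)) (hb : b ∈ translationGroup X) : a * b = b * a := by
  have : IsMulCommutative (translationGroup X) := Subgroup.isMulCommutative_closure (by
    rintro _ ⟨x, rfl⟩ _ ⟨y, rfl⟩
    exact translation_mul_comm x y)
  exact setLike_mul_comm ha hb

theorem mulLeft_conj_mem_translationGroup (h : permGroup X) (a : Equiv.Perm (permGroup X))
    (ha : a ∈ translationGroup X) :
    Equiv.mulLeft h * a * (Equiv.mulLeft h)⁻¹ ∈ translationGroup X := by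
  have hle : translationGroup X ≤
      (translationGroup X).comap (MulAut.conj (Equiv.mulLeft h)).toMonoidHom := by
    refine (Subgroup.closure_le _).2 ?_
    rintro _ ⟨y, rfl⟩
    change Equiv.mulLeft h * translation y * (Equiv.mulLeft h)⁻¹ ∈ translationGroup X
    rw [mulLeft_mul_translation]
    exact translation_mem _
  exact hle ha

/-- Right multiplication of a given `g` by `σ_x⁻¹` is the effect of the translation by `g • x`, and
by `σ_x` that of an inverse translation; the `σ_x` generate the group. -/
theorem exists_mem_translationGroup_apply_one (g : permGroup X) :
    ∃ a ∈ translationGroup X, a 1 = g := by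
  have hg : g ∈ Subgroup.closure (Set.range (permGroupSigma : X → permGroup X)) :=
    closure_range_permGroupSigma (X := X) ▸ Subgroup.mem_top g
  induction hg using Subgroup.closure_induction_right with
  | one => exact ⟨1, one_mem _, rfl⟩
  | mul_right g _ s hs ih =>
    obtain ⟨x, rfl⟩ := hs
    obtain ⟨a, ha, rfl⟩ := ih
    refine ⟨(translation ((a 1 * permGroupSigma x) • x))⁻¹ * a,
      mul_mem (inv_mem (translation_mem _)) ha, ?_⟩
    rw [Equiv.Perm.mul_apply, Equiv.Perm.inv_eq_iff_eq, translation_apply, inv_smul_smul,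
      mul_inv_cancel_right]
  | mul_inv_cancel g _ s hs ih =>
    obtain ⟨x, rfl⟩ := hs
    obtain ⟨a, ha, rfl⟩ := ih
    refine ⟨translation (a 1 • x) * a, mul_mem (translation_mem _) ha, ?_⟩
    rw [Equiv.Perm.mul_apply, translation_apply, inv_smul_smul]

/-- If the permutation group embeds into `P × Q` with `|P|` and `|Q|` coprime, then the component
of `σ_x` in `P` depends only on the orbit of `x` under the kernel of the projection to `P`. -/
theorem map_permGroupSigma_smul {P Q : Type*} [Group P] [Finite P] [Group Q] [Finite Q]
    (p : permGroup X →* P) (q : permGroup X →* Q) (hpq : ∀ g, p g = 1 → q g = 1 → g = 1)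
    (hcop : (Nat.card P).Coprime (Nat.card Q)) {h : permGroup X} (hh : p h = 1) (x : X) :
    p (permGroupSigma (h • x)) = p (permGroupSigma x) := by
  -- The translation by `x` sends `h⁻¹` to `h⁻¹ * σ_{h x}⁻¹` and `1` to `σ_x⁻¹`.
  have := map_apply_eq_map_apply_one translationGroup_mul_comm mulLeft_conj_mem_translationGroup
    exists_mem_translationGroup_apply_one p q hpq hcop (translation_mem x) (h := h⁻¹)
    (by rw [map_inv, hh, inv_one])
  simpa [translation_apply, hh] using this

/-- The cycle set structure on the orbits of a normal subgroup `N` of the permutation group, if the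
class of `σ_x` modulo `N` depends only on the orbit of `x`. -/
noncomputable abbrev orbitQuotient (N : Subgroup (permGroup X)) [hN : N.Normal]
    (hσ : ∀ h ∈ N, ∀ x : X, permGroupSigma (h • x) * (permGroupSigma x)⁻¹ ∈ N) :
    CycleSet (MulAction.orbitRel.Quotient N X) where
  mul := Quotient.map₂ (· * ·) (by
    rintro _ x ⟨⟨m, hm⟩, rfl⟩ _ y ⟨⟨n, hn⟩, rfl⟩
    -- This element carries `x * y` to `(m • x) * (n • y)`.
    refine ⟨⟨permGroupSigma (m • x) * n * (permGroupSigma (m • x))⁻¹ *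
      (permGroupSigma (m • x) * (permGroupSigma x)⁻¹),
      mul_mem (hN.conj_mem n hn _) (hσ m hm x)⟩, ?_⟩
    simp only [Subgroup.mk_smul]
    rw [← permGroupSigma_smul x y, ← permGroupSigma_smul (m • x) (n • y), ← mul_smul, ← mul_smul]
    group)
  bijective_left := fun a => Finite.surjective_iff_bijective.1 fun b =>
    Quotient.inductionOn₂' a b fun x y => by
      obtain ⟨z, hz⟩ := (bijective_left x).surjective y
      exact ⟨Quotient.mk'' z, congrArg Quotient.mk'' hz⟩
  cycloid := fun a b c => Quotient.inductionOn₃' a b c fun x y z =>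
    congrArg Quotient.mk'' (cycloid x y z)
  bijective_square := Finite.surjective_iff_bijective.1 fun b => Quotient.inductionOn' b fun y => by
    obtain ⟨z, hz⟩ := bijective_square.surjective y
    exact ⟨Quotient.mk'' z, congrArg Quotient.mk'' hz⟩

end CycleSet

/-! ### The decomposition theorem -/

theorem mainTheorem4 {X : Type u} [CycleSet X] [Finite X] [Nonempty X]
    (hX : CycleSet.Indecomposable X)
    (r : ℕ) (B : Fin r → Subgroup (CycleSet.permGroup X))
    (hB : IsInternalDirectProduct B)
    (hnontriv : ∀ i, B i ≠ ⊥)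
    (hcop : ∀ i j, i ≠ j → Nat.Coprime (Nat.card (B i)) (Nat.card (B j))) :
    ∃ (Y : Fin r → Type u) (_ : ∀ i, CycleSet (Y i)),
      Nonempty (X ≃* (∀ i, Y i)) ∧
      ∀ i, 1 < Nat.card (Y i) ∧ Nat.card (Y i) ∣ Nat.card (B i) := by
  have : MulAction.IsPretransitive (CycleSet.permGroup X) X := hX
  obtain ⟨e, he⟩ := hB.exists_mulEquiv
  let p (i : Fin r) : CycleSet.permGroup X →* B i := (Pi.evalMonoidHom _ i).comp e.toMonoidHom
  have hp : ∀ i g, p i g = e g i := fun _ _ => rfl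
  let q (i : Fin r) : CycleSet.permGroup X →* ∀ j : {j // j ≠ i}, B j :=
    MonoidHom.pi fun j => p j
  have hσ : ∀ i, ∀ h ∈ (p i).ker, ∀ x : X, CycleSet.permGroupSigma (h • x) *
      (CycleSet.permGroupSigma x)⁻¹ ∈ (p i).ker := by
    intro i h hh x
    rw [MonoidHom.mem_ker, map_mul, map_inv, mul_inv_eq_one]
    refine CycleSet.map_permGroupSigma_smul (p i) (q i) (fun g hg hg' => ?_) ?_ hh x
    · refine (map_eq_one_iff e e.injective).1 (funext fun j => ?_)
      by_cases hj : j = i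
      · exact hj ▸ hg
      · exact congrFun hg' ⟨j, hj⟩
    · rw [Nat.card_pi]
      exact Nat.Coprime.prod_right fun j _ => hcop _ _ j.2.symm
  have hbij := MulAction.bijective_pi_orbitQuotient_ker (X := X) (fun i j hij => hcop i j hij) e p hp
  let Y (i : Fin r) : Type u := MulAction.orbitRel.Quotient (p i).ker X
  let _ (i : Fin r) : CycleSet (Y i) := CycleSet.orbitQuotient (p i).ker (hσ i)
  refine ⟨Y, inferInstance, ⟨{ Equiv.ofBijective _ hbij with map_mul' := fun x y => rfl }⟩,
    fun i => ⟨?_, MulAction.card_orbitQuotient_ker_dvd (p i)⟩⟩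
  have : Finite (Y i) := Quotient.finite _
  have : Nonempty (Y i) := ‹Nonempty X›.map Quotient.mk''
  rw [Finite.one_lt_card_iff_nontrivial, ← not_subsingleton_iff_nontrivial]
  -- An element `b` of `B i` lies in every other kernel, so `x` and `b x` agree in every coordinate
  -- apart from `i`. If `Y i` is a single point, they are equal and `b = 1`.
  intro hsub
  refine hnontriv i ((Subgroup.eq_bot_iff_forall _).2 fun b hb => Subtype.ext (Equiv.ext fun x => ?_))
  refine hbij.injective (funext fun j => ?_)
  by_cases hj : j = i
  · subst hj
    exact hsub.elim _ _
  · refine Quotient.sound' ⟨⟨b, ?_⟩, rfl⟩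
    rw [MonoidHom.mem_ker, hp, he i ⟨b, hb⟩, Pi.mulSingle_eq_of_ne hj]
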